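/- Write $\mathbb N=\{1,2,\dots\}$. For $0\le x<1$ and an integer $p\ge 0$ let $Li_p(x)=\sum_{n\ge1}x^n/n^p$ (so $Li_0(x)=x/(1-x)$), and for integers $r\ge1$, $a,b\ge0$ with $a+b\ge1$ let $$K(r,a,b)=\int_0^1\frac{\log^r(x)\,Li_a(x)\,Li_b(x)}{x}\,dx .$$ Let $(t)_n=t(t+1)\cdots(t+n-1)$, $H_n^{(p)}=\sum_{j=1}^n j^{-p}$, and $S_{p,q}=\sum_{n\ge1}H_n^{(p)}/n^q$ for $p\ge 1$, $q\ge2$. Let $m,p,q\in\mathbb N$ with $p\ge q$. All the integrals $K(r,a,b)$ above converge absolutely, and $$\begin{aligned} K(m,p,q)={}&\sum_{x=1}^{q}K(m+p+x-1,0,q-x+1)\,\frac{(-1)^{p+x-1}}{(m+1)_{p+x-1}}\sum_{i_1=1}^{p}\ \sum_{i_2=1}^{p-i_1+1}\cdots\sum_{i_{x-1}=1}^{p-i_1-\cdots-i_{x-2}+x-2}1\\ &+\sum_{i_1=1}^{p}\frac{(-1)^{i_1}}{(m+1)_{i_1}}\cdots\sum_{i_q=1}^{p-i_1-\cdots-i_{q-1}+q-1}\frac{(-1)^{i_q}}{(m+i_1+\cdots+i_{q-1}+1)_{i_q}}\\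 &\qquad\times K(m+i_1+\cdots+i_q,\ p-i_1-\cdots-i_q+q,\ 0), \end{aligned}$$ where the nested sum in the first line is $1$ when $x=1$. For all $r,s\in\mathbb N$ the series $S_{s,r+1}$ converges and $$K(r,s,0)=K(r,0,s)=(-1)^r\,r!\,\bigl(S_{s,r+1}-\zeta(r+s+1)\bigr).$$ Suppose in addition that $m+p+q$ is even. Then for all $r,s\in\mathbb N$ with $r+s=m+p+q$ (which covers every integral on the right-hand side above), the sum $S_{s,r+1}$ is given, with $(a,b)=(s,r+1)$ and $w=a+b$ odd, by $$\begin{aligned} S_{a,b}={}&\zeta(w)\Bigl(\tfrac12-\tfrac{(-1)^a}{2}\tbinom{w-1}{a}-\tfrac{(-1)^a}{2}\tbinom{w-1}{b}\Bigr)+\tfrac{1-(-1)^a}{2}\zeta(a)\zeta(b)\\ &+(-1)^a\sum_{k=1}^{\lfloor a/2\rfloor}\tbinom{w-2k-1}{b-1}\zeta(2k)\zeta(w-2k)+(-1)^a\sum_{k=1}^{\lfloor b/2\rfloor}\tbinom{w-2k-1}{a-1}\zeta(2k)\zeta(w-2k), \end{aligned}$$ where $\zeta(1)$ is to be read as $0$.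 Consequently $K(m,p,q)$ reduces to zeta values: it is a linear combination with rational coefficients of $\zeta(m+p+q+1)$ and the products $\zeta(a)\zeta(b)$ with integers $a,b\ge2$, $a+b=m+p+q+1$. -/

import Mathlib

open MeasureTheory Finset

noncomputable section

/-- The polylogarithm `Li_p(x) = ∑_{n ≥ 1} x ^ n / n ^ p`, used for `0 ≤ x < 1`;
in particular `Li_0(x) = x / (1 - x)` there. -/
def polyLog (p : ℕ) (x : ℝ) : ℝ := ∑' n : ℕ, x ^ (n + 1) / ((n : ℝ) + 1) ^ p

/-- The integrand `log ^ r (x) * Li_p(x) * Li_q(x) / x`. -/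
def kIntegrand (r p q : ℕ) (x : ℝ) : ℝ :=
  Real.log x ^ r * polyLog p x * polyLog q x / x

/-- `K(r, p, q) = ∫_0^1 log ^ r (x) * Li_p(x) * Li_q(x) / x dx`. -/
def kInt (r p q : ℕ) : ℝ := ∫ x in (0 : ℝ)..1, kIntegrand r p q x

/-- The zeta value `ζ(k)` as a real number, with the convention `ζ(1) = 0`. -/
def zetaVal (k : ℕ) : ℝ := if k = 1 then 0 else (riemannZeta (k : ℂ)).re

/-- The generalized harmonic number `H_n^{(p)} = ∑_{j=1}^n 1 / j ^ p`. -/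
def genHarmonic (p n : ℕ) : ℝ := ∑ j ∈ Icc 1 n, 1 / (j : ℝ) ^ p

/-- The general term `H_n^{(p)} / n ^ q`, for `n = k + 1`, of the linear Euler sum. -/
def eulerTerm (p q k : ℕ) : ℝ := genHarmonic p (k + 1) / ((k : ℝ) + 1) ^ q

/-- The linear Euler sum `S_{p,q} = ∑_{n ≥ 1} H_n^{(p)} / n ^ q`. -/
def eulerSum (p q : ℕ) : ℝ := ∑' k : ℕ, eulerTerm p q k

/-- The expression in zeta values that evaluates `S_{p,q}` for `p + q` odd. -/
def eulerSumValue (p q : ℕ) : ℝ :=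
  zetaVal (p + q) *
      (1 / 2 - (-1) ^ p / 2 * ((p + q - 1).choose p : ℝ)
        - (-1) ^ p / 2 * ((p + q - 1).choose q : ℝ))
    + (1 - (-1) ^ p) / 2 * zetaVal p * zetaVal q
    + (-1) ^ p * ∑ k ∈ Icc 1 (p / 2),
        ((p + q - 2 * k - 1).choose (q - 1) : ℝ) * zetaVal (2 * k) * zetaVal (p + q - 2 * k)
    + (-1) ^ p * ∑ k ∈ Icc 1 (q / 2),
        ((p + q - 2 * k - 1).choose (p - 1) : ℝ) * zetaVal (2 * k) * zetaVal (p + q - 2 * k)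

/-- The Pochhammer symbol `(t)_n = t (t + 1) ⋯ (t + n - 1)` for a natural number `t`. -/
def poch (t n : ℕ) : ℝ := (t.ascFactorial n : ℝ)

/-- The nested sum
`∑_{i_1 = 1}^{p} ∑_{i_2 = 1}^{p - i_1 + 1} ⋯ ∑_{i_k = 1}^{p - i_1 - ⋯ - i_{k-1} + k - 1}
  f [i_1, …, i_k]`;
for `k = 0` it is `f []`. -/
def nestedSum : ℕ → ℕ → (List ℕ → ℝ) → ℝ
  | 0, _, f => f []
  | k + 1, p, f => ∑ i ∈ Icc 1 p, nestedSum k (p - i + 1) (fun l => f (i :: l))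

/-- The product of the factors
`(-1) ^ {i_j} / (m + i_1 + ⋯ + i_{j-1} + 1)_{i_j}` over `j = 1, …, k`, for `[i_1, …, i_k]`. -/
def nestedCoeff : ℕ → List ℕ → ℝ
  | _, [] => 1
  | m, i :: l => (-1) ^ i / poch (m + 1) i * nestedCoeff (m + i) l

/-- The zeta value `ζ(w)` and the products `ζ(a) ζ(b)` with `a, b ≥ 2` and `a + b = w`. -/
def zetaProducts (w : ℕ) : Set ℝ :=
  {z | z = zetaVal w ∨ ∃ a b : ℕ, 2 ≤ a ∧ 2 ≤ b ∧ a + b = w ∧ z = zetaVal a * zetaVal b}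

end

/-!
Expanding both polylogarithms and integrating termwise turns `K(r, a, b)` into `(-1) ^ r * r!` times
the Tornheim series `T(a, b, c) = ∑ 1 / (j ^ a k ^ b (j + k) ^ c)` with `c = r + 1`
(`kInt_eq_tornheim`). The partial fraction `1 / (j k) = (1 / j + 1 / k) / (j + k)` gives
`T(a, b, c) = T(a - 1, b, c + 1) + T(a, b - 1, c + 1)`, which is integration by parts for `K`.
Iterating it yields the nested sum formula (`kInt_eq_nestedSum`), and grouping `T(0, s, r + 1)` by
the value of `j + k` gives the Euler sums (`eulerSum_eq_tornheim`).

The evaluation of `S_{a,b}` for odd weight `w = a + b` rests on the two-sided series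
`B_n(p, q) = ∑ 1 / (k ^ p (n - k) ^ q)` over the integers `k ≠ 0, n`. Splitting it at `0` and `n` and
summing over `n ≥ 1` gives, for `p, q ≥ 2`,
`ζ(p) ζ(q) + (-1) ^ q T(0, q, p) + (-1) ^ p T(0, p, q)` (`hasSum_bilateralSum`). Expanding in
partial fractions instead gives a closed form, in which only even zeta values enter from the
sum over `k`, because `∑_{k ≠ 0} k ^ (-i)` vanishes for odd `i` (`bilateralSum_succ_succ`,
`hasSum_partialFractionSum`). For odd weight the two Tornheim series have opposite signs, so this
determines their difference, while their sum is `ζ(p) ζ(q) - ζ(w)` by the symmetric sum relation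
(`tornheim_add_tornheim_swap`). The remaining case `a = 1` is Euler's formula, which follows from
the sum formula obtained by evaluating `T(w - 2, 1, 1)` in two ways (`eulerSum_one`).

Finally the recursion expresses `K(m, p, q)` rationally through integrals `K(r, 0, s)` of the same
weight, hence through `ζ(w)` and products of two zeta values (`kInt_mem_span`).
-/

/-! ### Zeta values and harmonic numbers -/

theorem hasSum_of_forall_eq {ι : Type*} {f g : ι → ℝ} {a : ℝ} (h : ∀ i, f i = g i)
    (hg : HasSum g a) : HasSum f a := by
  rwa [funext h]

theorem hasSum_zetaVal {k : ℕ} (hk : 2 ≤ k) :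
    HasSum (fun n : ℕ => 1 / ((n : ℝ) + 1) ^ k) (zetaVal k) := by
  have hs : Summable (fun n : ℕ => 1 / (n : ℝ) ^ k) := Real.summable_one_div_nat_pow.2 (by omega)
  have hz : zetaVal k = ∑' n : ℕ, 1 / (n : ℝ) ^ k := by
    rw [zetaVal, if_neg (by omega), zeta_nat_eq_tsum_of_gt_one (by omega)]
    have : ((∑' n : ℕ, 1 / (n : ℝ) ^ k : ℝ) : ℂ) = ∑' n : ℕ, 1 / (n : ℂ) ^ k := by
      push_cast; rfl
    rw [← this, Complex.ofReal_re]
  have h := (hasSum_nat_add_iff' 1).2 hs.hasSum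
  rw [← hz] at h
  have hk0 : k ≠ 0 := by omega
  simpa [hk0] using h

theorem genHarmonic_zero (p : ℕ) : genHarmonic p 0 = 0 := by simp [genHarmonic]

theorem genHarmonic_succ (p n : ℕ) :
    genHarmonic p (n + 1) = genHarmonic p n + 1 / ((n : ℝ) + 1) ^ p := by
  rw [genHarmonic, Finset.sum_Icc_succ_top (by omega)]
  simp [genHarmonic]

theorem genHarmonic_eq_sum_range (p n : ℕ) :
    genHarmonic p n = ∑ j ∈ range n, 1 / ((j : ℝ) + 1) ^ p := by
  induction n with
  | zero => simp [genHarmonic_zero]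
  | succ n ih => rw [genHarmonic_succ, ih, Finset.sum_range_succ]

theorem tendsto_genHarmonic {p : ℕ} (hp : 2 ≤ p) :
    Filter.Tendsto (genHarmonic p) Filter.atTop (nhds (zetaVal p)) := by
  have h := (hasSum_zetaVal hp).tendsto_sum_nat
  exact h.congr fun n => (genHarmonic_eq_sum_range p n).symm

/-- A telescoping series: `∑_{j ≥ 1} 1 / (j (j + n)) = H_n / n`. -/
theorem hasSum_one_div_mul_add {n : ℕ} (hn : 1 ≤ n) :
    HasSum (fun j : ℕ => 1 / (((j : ℝ) + 1) * ((j : ℝ) + 1 + n))) (genHarmonic 1 n / n) := by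
  have key : ∀ n : ℕ,
      HasSum (fun j : ℕ => 1 / ((j : ℝ) + 1) - 1 / ((j : ℝ) + 1 + n)) (genHarmonic 1 n) := by
    intro n
    induction n with
    | zero => simp [genHarmonic_zero]
    | succ n ih =>
      have htel : HasSum (fun j : ℕ => 1 / ((j : ℝ) + 1 + n) - 1 / ((j : ℝ) + 1 + n + 1))
          (1 / ((n : ℝ) + 1)) := by
        rw [hasSum_iff_tendsto_nat_of_nonneg]
        · have hsum : ∀ N : ℕ, ∑ j ∈ range N,
              (1 / ((j : ℝ) + 1 + n) - 1 / ((j : ℝ) + 1 + n + 1)) =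
              1 / ((n : ℝ) + 1) - 1 / ((N : ℝ) + (n + 1)) := by
            intro N
            have := Finset.sum_range_sub' (fun j : ℕ => 1 / ((j : ℝ) + 1 + n)) N
            push_cast at this
            rw [show (0 : ℝ) + 1 + n = n + 1 by ring,
              show (N : ℝ) + 1 + n = N + (n + 1) by ring] at this
            rw [← this]
            refine Finset.sum_congr rfl fun j _ => ?_
            ring_nf
          simp_rw [hsum]
          have h0 : Filter.Tendsto (fun N : ℕ => 1 / ((N : ℝ) + (n + 1))) Filter.atTop
              (nhds 0) := by
            simp_rw [one_div]
            exact tendsto_inv_atTop_zero.comp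
              (Filter.tendsto_atTop_add_const_right _ _ tendsto_natCast_atTop_atTop)
          simpa using h0.const_sub (1 / ((n : ℝ) + 1))
        · intro j
          rw [sub_nonneg]
          exact one_div_le_one_div_of_le (by positivity) (by linarith)
      have := ih.add htel
      rw [genHarmonic_succ, pow_one]
      refine hasSum_of_forall_eq (fun j => ?_) this
      push_cast
      ring_nf
  have h := (key n).div_const (n : ℝ)
  refine hasSum_of_forall_eq (fun j => ?_) h
  have : (n : ℝ) ≠ 0 := by positivity
  have : (j : ℝ) + 1 + n ≠ 0 := by positivity
  field_simp
  ring

/-! ### Tornheim double series -/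

/-- The term `1 / (j ^ a * k ^ b * (j + k) ^ c)` of the Tornheim double series, where
`j = x.1 + 1` and `k = x.2 + 1`. -/
noncomputable def tornheimTerm (a b c : ℕ) (x : ℕ × ℕ) : ℝ :=
  1 / (((x.1 : ℝ) + 1) ^ a * ((x.2 : ℝ) + 1) ^ b * ((x.1 : ℝ) + x.2 + 2) ^ c)

/-- The Tornheim double series `T(a, b, c) = ∑_{j, k ≥ 1} 1 / (j ^ a * k ^ b * (j + k) ^ c)`. -/
noncomputable def tornheim (a b c : ℕ) : ℝ := ∑' x, tornheimTerm a b c x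

theorem tornheimTerm_nonneg (a b c : ℕ) (x : ℕ × ℕ) : 0 ≤ tornheimTerm a b c x := by
  unfold tornheimTerm; positivity

theorem tornheimTerm_le {a b c a' b' c' : ℕ} (ha : a' ≤ a) (hb : b' ≤ b) (hc : c' ≤ c)
    (x : ℕ × ℕ) : tornheimTerm a b c x ≤ tornheimTerm a' b' c' x := by
  unfold tornheimTerm
  have h1 : (1 : ℝ) ≤ (x.1 : ℝ) + 1 := by simp
  have h2 : (1 : ℝ) ≤ (x.2 : ℝ) + 1 := by simp
  have h3 : (1 : ℝ) ≤ (x.1 : ℝ) + x.2 + 2 := by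
    have : (0 : ℝ) ≤ (x.1 : ℝ) + x.2 := by positivity
    linarith
  apply one_div_le_one_div_of_le (by positivity)
  gcongr

theorem tornheimTerm_swap (a b c : ℕ) (x : ℕ × ℕ) :
    tornheimTerm a b c x.swap = tornheimTerm b a c x := by
  unfold tornheimTerm
  simp only [Prod.fst_swap, Prod.snd_swap]
  congr 1
  ring

theorem summable_tornheimTerm_swap {a b c : ℕ} (h : Summable (tornheimTerm a b c)) :
    Summable (tornheimTerm b a c) :=
  ((Equiv.prodComm ℕ ℕ).summable_iff.2 h).congr fun x => (tornheimTerm_swap a b c x)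

theorem tornheim_comm (a b c : ℕ) : tornheim a b c = tornheim b a c := by
  unfold tornheim
  rw [← (Equiv.prodComm ℕ ℕ).tsum_eq]
  exact tsum_congr fun x => tornheimTerm_swap a b c x

/-- All convergent cases are dominated by the product series `∑ j ^ (-3/2) * ∑ k ^ (-3/2)`. -/
theorem summable_tornheimTerm_of_le {a b c : ℕ}
    (h : ∀ u v : ℝ, 1 ≤ u → 1 ≤ v →
      u ^ 3 * v ^ 3 ≤ (u ^ 2) ^ a * (v ^ 2) ^ b * (u ^ 2 + v ^ 2) ^ c) :
    Summable (tornheimTerm a b c) := by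
  have h1 : Summable (fun n : ℕ => 1 / (Real.sqrt ((n : ℝ) + 1)) ^ 3) := by
    have h0 : Summable (fun n : ℕ => 1 / ((n : ℝ)) ^ (3 / 2 : ℝ)) :=
      Real.summable_one_div_nat_rpow.2 (by norm_num)
    refine ((summable_nat_add_iff 1).2 h0).congr fun n => ?_
    rw [Real.sqrt_eq_rpow, ← Real.rpow_natCast, ← Real.rpow_mul (by positivity)]
    norm_num
  refine Summable.of_nonneg_of_le (tornheimTerm_nonneg a b c) (fun x => ?_)
    (h1.mul_of_nonneg h1 (fun n => by positivity) (fun n => by positivity))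
  have hu : (1 : ℝ) ≤ Real.sqrt ((x.1 : ℝ) + 1) := Real.one_le_sqrt.2 (by simp)
  have hv : (1 : ℝ) ≤ Real.sqrt ((x.2 : ℝ) + 1) := Real.one_le_sqrt.2 (by simp)
  have key := h _ _ hu hv
  rw [Real.sq_sqrt (by positivity), Real.sq_sqrt (by positivity)] at key
  unfold tornheimTerm
  rw [div_mul_div_comm, one_mul]
  apply one_div_le_one_div_of_le (by positivity)
  rwa [show (x.1 : ℝ) + x.2 + 2 = (x.1 : ℝ) + 1 + (x.2 + 1) by ring]

theorem summable_tornheimTerm_one_zero_two : Summable (tornheimTerm 1 0 2) := by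
  refine summable_tornheimTerm_of_le fun u v hu hv => ?_
  have hu0 : 0 ≤ u := by linarith
  have hv0 : 0 ≤ v := by linarith
  have h1 : u * v ≤ u ^ 2 + v ^ 2 := by nlinarith [sq_nonneg (u - v)]
  have h2 : v ^ 2 ≤ u ^ 2 + v ^ 2 := by nlinarith [sq_nonneg u]
  calc u ^ 3 * v ^ 3 = u ^ 2 * ((u * v) * v ^ 2) := by ring
    _ ≤ u ^ 2 * ((u ^ 2 + v ^ 2) * (u ^ 2 + v ^ 2)) := by gcongr
    _ = _ := by ring

theorem summable_tornheimTerm_one_one_one : Summable (tornheimTerm 1 1 1) := by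
  refine summable_tornheimTerm_of_le fun u v hu hv => ?_
  have hu0 : 0 ≤ u := by linarith
  have hv0 : 0 ≤ v := by linarith
  have h1 : u * v ≤ u ^ 2 + v ^ 2 := by nlinarith [sq_nonneg (u - v)]
  calc u ^ 3 * v ^ 3 = u ^ 2 * v ^ 2 * (u * v) := by ring
    _ ≤ u ^ 2 * v ^ 2 * (u ^ 2 + v ^ 2) := by gcongr
    _ = _ := by ring

theorem summable_tornheimTerm {a b c : ℕ} (hab : 1 ≤ a + b) (hc : 2 ≤ c) :
    Summable (tornheimTerm a b c) := by
  rcases Nat.eq_zero_or_pos a with ha | ha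
  · exact Summable.of_nonneg_of_le (tornheimTerm_nonneg a b c)
      (tornheimTerm_le (a' := 0) (b' := 1) (c' := 2) (by omega) (by omega) hc)
      (summable_tornheimTerm_swap summable_tornheimTerm_one_zero_two)
  · exact Summable.of_nonneg_of_le (tornheimTerm_nonneg a b c)
      (tornheimTerm_le (a' := 1) (b' := 0) (c' := 2) (by omega) (by omega) hc)
      summable_tornheimTerm_one_zero_two

/-- The partial fraction identity `1 / (j k) = (1 / j + 1 / k) / (j + k)`. -/
theorem tornheimTerm_succ_succ (a b c : ℕ) (x : ℕ × ℕ) :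
    tornheimTerm (a + 1) (b + 1) c x =
      tornheimTerm a (b + 1) (c + 1) x + tornheimTerm (a + 1) b (c + 1) x := by
  unfold tornheimTerm
  have h3 : (x.1 : ℝ) + x.2 + 2 ≠ 0 := by positivity
  field_simp
  ring

theorem tornheim_succ_succ {a b c : ℕ} (hc : 1 ≤ c) :
    tornheim (a + 1) (b + 1) c = tornheim a (b + 1) (c + 1) + tornheim (a + 1) b (c + 1) := by
  unfold tornheim
  rw [← Summable.tsum_add (summable_tornheimTerm (by omega) (by omega))
    (summable_tornheimTerm (by omega) (by omega))]
  exact tsum_congr fun x => tornheimTerm_succ_succ a b c x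

/-! ### Linear Euler sums as Tornheim series -/

/-- Summation of a double series along the antidiagonals. -/
theorem HasSum.sum_antidiagonal {f : ℕ × ℕ → ℝ} {a : ℝ} (hf : HasSum f a) :
    HasSum (fun n : ℕ => ∑ x ∈ antidiagonal n, f x) a := by
  have h := (HasAntidiagonal.sigmaAntidiagonalEquivProd (A := ℕ)).hasSum_iff.2 hf
  refine h.sigma fun n => ?_
  rw [← Finset.sum_coe_sort]
  exact hasSum_fintype _

/-- Grouping `T(0, s, c)` by the value of `j + k` gives `∑_n H_{n-1}^{(s)} / n ^ c`. -/
theorem hasSum_eulerTerm {s c : ℕ} (hs : 1 ≤ s) (hc : 2 ≤ c) :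
    HasSum (eulerTerm s c) (tornheim 0 s c + zetaVal (s + c)) := by
  have h1 : HasSum (fun n : ℕ => genHarmonic s n / ((n : ℝ) + 1) ^ c) (tornheim s 0 c) := by
    rw [← hasSum_nat_add_iff' 1]
    have h := (summable_tornheimTerm (a := s) (b := 0) (c := c) (by omega) hc).hasSum
    have h2 := h.sum_antidiagonal
    simp only [Finset.sum_range_one, genHarmonic_zero, zero_div, sub_zero]
    refine hasSum_of_forall_eq (fun n => ?_) h2
    rw [Finset.Nat.sum_antidiagonal_eq_sum_range_succ_mk, genHarmonic_eq_sum_range,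
      Finset.sum_div]
    refine Finset.sum_congr rfl fun j hj => ?_
    have hjn : j ≤ n := Nat.lt_succ_iff.1 (Finset.mem_range.1 hj)
    simp only [tornheimTerm, Nat.cast_sub hjn, pow_zero, mul_one]
    rw [div_div]
    push_cast
    ring_nf
  rw [tornheim_comm]
  refine hasSum_of_forall_eq (fun n => ?_) (h1.add (hasSum_zetaVal (k := s + c) (by omega)))
  rw [eulerTerm, genHarmonic_succ, add_div, div_div, ← pow_add]

theorem eulerSum_eq_tornheim {s c : ℕ} (hs : 1 ≤ s) (hc : 2 ≤ c) :
    eulerSum s c = tornheim 0 s c + zetaVal (s + c) :=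
  (hasSum_eulerTerm hs hc).tsum_eq

/-- Summing `1 / (j k ^ q (j + k))` over `j` first produces the harmonic numbers `H_k`. -/
theorem tornheim_right_one_one {q : ℕ} (hq : 1 ≤ q) :
    tornheim q 1 1 = eulerSum 1 (q + 1) := by
  have hs : Summable (tornheimTerm q 1 1) :=
    Summable.of_nonneg_of_le (tornheimTerm_nonneg q 1 1)
      (tornheimTerm_le hq le_rfl le_rfl) summable_tornheimTerm_one_one_one
  refine (HasSum.tsum_eq (hs.hasSum.prod_fiberwise fun k => ?_)).symm
  have h := (hasSum_one_div_mul_add (n := k + 1) (by omega)).mul_left (1 / ((k : ℝ) + 1) ^ q)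
  have he : eulerTerm 1 (q + 1) k
      = 1 / ((k : ℝ) + 1) ^ q * (genHarmonic 1 (k + 1) / ((k + 1 : ℕ) : ℝ)) := by
    rw [eulerTerm]
    push_cast
    field_simp
    ring
  rw [he]
  refine hasSum_of_forall_eq (fun j => ?_) h
  simp only [tornheimTerm]
  rw [div_mul_div_comm]
  push_cast
  ring_nf

/-- Unfolding the recursion at exponent `1`, until one of the first two exponents is zero. Together
with `tornheim_right_one_one` the case `c = 1` gives the sum formula
`∑_{i + j = w, i ≥ 1, j ≥ 2} T(0, i, j) = ζ(w)`. -/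
theorem tornheim_succ_one_eq_sum (q c : ℕ) (hc : 1 ≤ c) :
    tornheim (q + 1) 1 c =
      ∑ i ∈ range (q + 1), tornheim 0 (i + 1) (q + c + 1 - i) + tornheim 0 1 (q + c + 1) := by
  induction q generalizing c with
  | zero =>
    rw [tornheim_succ_succ hc, tornheim_comm (0 + 1) 0]
    simp
  | succ q ih =>
    rw [tornheim_succ_succ hc, ih (c + 1) (by omega), Finset.sum_range_succ _ (q + 1),
      tornheim_comm (q + 1 + 1) 0]
    have h1 : q + (c + 1) + 1 = q + 1 + c + 1 := by ring
    have h2 : q + 1 + c + 1 - (q + 1) = c + 1 := by omega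
    rw [h1, h2]
    ring

/-- The symmetric sum (stuffle) relation for linear Euler sums. -/
theorem eulerSum_add_eulerSum_swap {p q : ℕ} (hp : 2 ≤ p) (hq : 2 ≤ q) :
    eulerSum p q + eulerSum q p = zetaVal p * zetaVal q + zetaVal (p + q) := by
  -- The identity already holds for the partial sums, as `H_N^{(p)} H_N^{(q)}`.
  have hfin : ∀ N : ℕ, genHarmonic p N * genHarmonic q N =
      ∑ k ∈ range N, (eulerTerm p q k + eulerTerm q p k - 1 / ((k : ℝ) + 1) ^ (p + q)) := by
    intro N
    induction N with
    | zero => simp [genHarmonic_zero]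
    | succ N ih =>
      rw [Finset.sum_range_succ, ← ih]
      simp only [eulerTerm, genHarmonic_succ]
      field_simp
      ring
  have h1 := (tendsto_genHarmonic hp).mul (tendsto_genHarmonic hq)
  simp_rw [hfin] at h1
  have hpq := (hasSum_eulerTerm (s := p) (c := q) (by omega) hq).summable.hasSum
  have hqp := (hasSum_eulerTerm (s := q) (c := p) (by omega) hp).summable.hasSum
  have h2 := ((hpq.add hqp).sub (hasSum_zetaVal (k := p + q) (by omega))).tendsto_sum_nat
  have := tendsto_nhds_unique h1 h2
  change _ = eulerSum p q + eulerSum q p - _ at this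
  linarith

theorem tornheim_add_tornheim_swap {p q : ℕ} (hp : 2 ≤ p) (hq : 2 ≤ q) :
    tornheim 0 p q + tornheim 0 q p = zetaVal p * zetaVal q - zetaVal (p + q) := by
  have h := eulerSum_add_eulerSum_swap hp hq
  rw [eulerSum_eq_tornheim (by omega) hq, eulerSum_eq_tornheim (by omega) hp,
    add_comm q p] at h
  linarith

/-! ### Euler's evaluation of `S_{1,b}` -/

/-- Euler's formula for `S_{1,b}`: the sum formula `ζ(w) = ∑_{j=1}^{w-2} T(0, j, w - j)` leaves
`T(0, 1, w - 1)` as the only summand that is not paired off by the symmetric sum relation. -/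
theorem eulerSum_one (q : ℕ) :
    eulerSum 1 (q + 2) = zetaVal (q + 3) * (2 + (q : ℝ) / 2) -
      (∑ j ∈ range q, zetaVal (j + 2) * zetaVal (q + 1 - j)) / 2 := by
  have h1 := tornheim_right_one_one (q := q + 1) (by omega)
  rw [tornheim_succ_one_eq_sum q 1 le_rfl] at h1
  have h2 := eulerSum_eq_tornheim (s := 1) (c := q + 2) le_rfl (by omega)
  rw [show 1 + (q + 2) = q + 3 by ring] at h2
  rw [show q + 1 + 1 = q + 2 by ring, h2, Finset.sum_range_succ'] at h1
  set A := ∑ j ∈ range q, tornheim 0 (j + 2) (q + 1 - j) with hA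
  have h3 : ∑ i ∈ range q, tornheim 0 (i + 1 + 1) (q + 2 - (i + 1)) = A :=
    Finset.sum_congr rfl fun i _ => by
      rw [show q + 2 - (i + 1) = q + 1 - i by omega]
  rw [h3] at h1
  have h4 : A = ∑ j ∈ range q, tornheim 0 (q + 1 - j) (j + 2) := by
    rw [hA, ← Finset.sum_range_reflect]
    refine Finset.sum_congr rfl fun j hj => ?_
    have := Finset.mem_range.1 hj
    rw [show q - 1 - j + 2 = q + 1 - j by omega, show q + 1 - (q - 1 - j) = j + 2 by omega]
  have h5 : A + A = ∑ j ∈ range q, (zetaVal (j + 2) * zetaVal (q + 1 - j) - zetaVal (q + 3)) := by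
    nth_rewrite 2 [h4]
    rw [hA, ← Finset.sum_add_distrib]
    refine Finset.sum_congr rfl fun j hj => ?_
    have := Finset.mem_range.1 hj
    rw [tornheim_add_tornheim_swap (by omega) (by omega),
      show j + 2 + (q + 1 - j) = q + 3 by omega]
  rw [Finset.sum_sub_distrib, Finset.sum_const, Finset.card_range, nsmul_eq_mul] at h5
  simp only [zero_add, Nat.sub_zero] at h1
  rw [h2]
  linarith

theorem sum_Icc_one (t : ℕ) (f : ℕ → ℝ) : ∑ k ∈ Icc 1 t, f k = ∑ i ∈ range t, f (i + 1) := by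
  induction t with
  | zero => simp
  | succ t ih => rw [Finset.sum_Icc_succ_top (by omega), ih, Finset.sum_range_succ]

/-- For a symmetric summand the even and the odd indices contribute equally. -/
theorem sum_range_two_mul_of_symm (t : ℕ) (f : ℕ → ℝ)
    (hf : ∀ j < 2 * t, f j = f (2 * t - 1 - j)) :
    ∑ j ∈ range (2 * t), f j = 2 * ∑ i ∈ range t, f (2 * i) := by
  have h1 : ∀ t : ℕ, ∑ j ∈ range (2 * t), f j =
      ∑ i ∈ range t, f (2 * i) + ∑ i ∈ range t, f (2 * i + 1) := by
    intro t
    induction t with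
    | zero => simp
    | succ t ih =>
      rw [show 2 * (t + 1) = 2 * t + 1 + 1 by ring, Finset.sum_range_succ, Finset.sum_range_succ,
        ih, Finset.sum_range_succ, Finset.sum_range_succ]
      ring
  rw [h1, two_mul]
  congr 1
  rw [← Finset.sum_range_reflect]
  refine Finset.sum_congr rfl fun i hi => ?_
  have := Finset.mem_range.1 hi
  rw [hf _ (by omega)]
  congr 1
  omega

theorem zetaVal_one : zetaVal 1 = 0 := by simp [zetaVal]

theorem eulerSum_one_eq_eulerSumValue {b : ℕ} (hb : 2 ≤ b) (hodd : Odd (1 + b)) :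
    eulerSum 1 b = eulerSumValue 1 b := by
  obtain ⟨t, ht⟩ : ∃ t, b = 2 * t + 2 := by
    obtain ⟨u, hu⟩ := hodd
    exact ⟨u - 1, by omega⟩
  subst ht
  rw [eulerSum_one, sum_range_two_mul_of_symm]
  · have h1 : ∑ k ∈ Icc 1 ((2 * t + 2) / 2),
        ((1 + (2 * t + 2) - 2 * k - 1).choose (1 - 1) : ℝ) * zetaVal (2 * k) *
          zetaVal (1 + (2 * t + 2) - 2 * k) =
        ∑ i ∈ range t, zetaVal (2 * i + 2) * zetaVal (2 * t + 1 - 2 * i) := by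
      rw [show (2 * t + 2) / 2 = t + 1 by omega, Finset.sum_Icc_succ_top (by omega),
        show 1 + (2 * t + 2) - 2 * (t + 1) = 1 by omega, zetaVal_one, mul_zero, add_zero,
        sum_Icc_one]
      refine Finset.sum_congr rfl fun i _ => ?_
      rw [Nat.sub_self, Nat.choose_zero_right, Nat.cast_one, one_mul,
        show 2 * (i + 1) = 2 * i + 2 by ring,
        show 1 + (2 * t + 2) - (2 * i + 2) = 2 * t + 1 - 2 * i by omega]
    rw [eulerSumValue, h1, zetaVal_one]
    rw [show 1 + (2 * t + 2) - 1 = 2 * t + 2 by omega, Nat.choose_self, Nat.choose_one_right,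
      show 1 + (2 * t + 2) = 2 * t + 3 by ring]
    simp
    ring
  · intro j hj
    rw [mul_comm, show 2 * t - 1 - j + 2 = 2 * t + 1 - j by omega,
      show 2 * t + 1 - (2 * t - 1 - j) = j + 2 by omega]

/-! ### A two-sided series and its evaluation by partial fractions -/

/-- The term `1 / (k ^ p * (n - k) ^ q)` for `k ∈ ℤ`, with `k = 0` and `k = n` left out whatever
the exponents are. -/
noncomputable def bilateralTerm (n p q : ℕ) (k : ℤ) : ℝ :=
  if k = 0 ∨ k = n then 0 else 1 / ((k : ℝ) ^ p * ((n : ℝ) - k) ^ q)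

/-- The series `∑ 1 / (k ^ p * (n - k) ^ q)` over the integers `k ≠ 0, n`. -/
noncomputable def bilateralSum (n p q : ℕ) : ℝ := ∑' k : ℤ, bilateralTerm n p q k

theorem summable_bilateralTerm {n p q : ℕ} (hpq : 2 ≤ p + q) :
    Summable (bilateralTerm n p q) := by
  have h1 : Summable (fun k : ℤ => 1 / (k : ℝ) ^ 2) := Real.summable_one_div_int_pow.2 (by omega)
  have h2 : Summable (fun k : ℤ => 1 / ((n : ℝ) - k) ^ 2) :=
    ((Equiv.subLeft (n : ℤ)).summable_iff.2 h1).congr fun k => by simp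
  refine Summable.of_norm_bounded (h1.add h2) fun k => ?_
  unfold bilateralTerm
  split_ifs with h
  · rw [norm_zero]; positivity
  · push Not at h
    have ha : |((k : ℝ))|⁻¹ ≤ 1 := by
      refine inv_le_one_of_one_le₀ ?_
      exact_mod_cast Int.one_le_abs h.1
    have hb : |(n : ℝ) - k|⁻¹ ≤ 1 := by
      refine inv_le_one_of_one_le₀ ?_
      exact_mod_cast Int.one_le_abs (sub_ne_zero.2 (Ne.symm h.2))
    rw [Real.norm_eq_abs, abs_div, abs_one, abs_mul, abs_pow, abs_pow, ← sq_abs (k : ℝ),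
      ← sq_abs ((n : ℝ) - k), one_div, mul_inv, one_div, one_div, ← inv_pow, ← inv_pow, ← inv_pow,
      ← inv_pow]
    have ha0 : 0 ≤ |((k : ℝ))|⁻¹ := by positivity
    have hb0 : 0 ≤ |(n : ℝ) - k|⁻¹ := by positivity
    generalize |((k : ℝ))|⁻¹ = a at *
    generalize |(n : ℝ) - k|⁻¹ = b at *
    by_cases hp : 2 ≤ p
    · have := pow_le_pow_of_le_one ha0 ha hp
      have := pow_le_one₀ (n := q) hb0 hb
      nlinarith [sq_nonneg b, pow_nonneg hb0 q, pow_nonneg ha0 p]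
    by_cases hq : 2 ≤ q
    · have := pow_le_pow_of_le_one hb0 hb hq
      have := pow_le_one₀ (n := p) ha0 ha
      nlinarith [sq_nonneg a, pow_nonneg hb0 q, pow_nonneg ha0 p]
    · have hp1 : p = 1 := by omega
      have hq1 : q = 1 := by omega
      subst hp1 hq1
      nlinarith [sq_nonneg (a - b), sq_nonneg (a + b)]

theorem bilateralSum_comm (n p q : ℕ) : bilateralSum n p q = bilateralSum n q p := by
  unfold bilateralSum
  rw [← (Equiv.subLeft (n : ℤ)).tsum_eq]
  refine tsum_congr fun k => ?_
  simp only [bilateralTerm, Equiv.subLeft_apply]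
  have : ((n : ℤ) - k = 0 ∨ (n : ℤ) - k = n) ↔ (k = 0 ∨ k = n) := by omega
  rw [if_congr this rfl rfl]
  split_ifs
  · rfl
  · push_cast
    rw [sub_sub_cancel, mul_comm]

theorem mul_bilateralSum_succ_succ {n p q : ℕ} (hpq : 1 ≤ p + q) :
    (n : ℝ) * bilateralSum n (p + 1) (q + 1) =
      bilateralSum n p (q + 1) + bilateralSum n (p + 1) q := by
  unfold bilateralSum
  rw [← Summable.tsum_add (summable_bilateralTerm (by omega)) (summable_bilateralTerm (by omega)),
    ← tsum_mul_left]
  refine tsum_congr fun k => ?_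
  unfold bilateralTerm
  split_ifs with h
  · simp
  · push Not at h
    have h1 : (k : ℝ) ≠ 0 := by exact_mod_cast h.1
    have h2 : (n : ℝ) - k ≠ 0 := by
      rw [sub_ne_zero]; exact_mod_cast (Ne.symm h.2)
    field_simp
    ring

/-- The term `-1 / n ^ p` accounts for the omitted index `k = n`. -/
theorem bilateralSum_zero_right {n p : ℕ} (hn : 1 ≤ n) (hp : 2 ≤ p) :
    bilateralSum n p 0 = (1 + (-1) ^ p) * zetaVal p - 1 / (n : ℝ) ^ p := by
  have hp0 : p ≠ 0 := by omega
  have h0 : HasSum (fun k : ℤ => 1 / (k : ℝ) ^ p) (zetaVal p + (-1) ^ p * zetaVal p) := by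
    refine HasSum.of_nat_of_neg_add_one ?_ ?_
    · rw [← hasSum_nat_add_iff' 1]
      simpa [hp0] using hasSum_zetaVal hp
    · refine hasSum_of_forall_eq (fun k => ?_) ((hasSum_zetaVal hp).mul_left ((-1) ^ p))
      push_cast
      rw [← neg_one_mul, mul_pow, one_div, mul_inv, ← inv_pow]
      norm_num
  have h1 := h0.sub (hasSum_ite_eq (n : ℤ) (1 / (n : ℝ) ^ p))
  have h2 : ∀ k, bilateralTerm n p 0 k =
      1 / (k : ℝ) ^ p - if k = (n : ℤ) then 1 / (n : ℝ) ^ p else 0 := by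
    intro k
    unfold bilateralTerm
    by_cases hk0 : k = 0
    · subst hk0
      have : (0 : ℤ) ≠ n := by exact_mod_cast (by omega : 0 ≠ n)
      simp [hp0, this]
    · by_cases hkn : k = n
      · simp [hkn]
      · simp [hk0, hkn]
  rw [bilateralSum, (hasSum_of_forall_eq h2 h1).tsum_eq]
  ring

theorem summable_tornheimTerm_row (p q i : ℕ) (hpq : 2 ≤ p + q) :
    Summable (fun l : ℕ => tornheimTerm 0 p q (i, l)) := by
  refine Summable.of_nonneg_of_le (fun l => tornheimTerm_nonneg 0 p q (i, l)) (fun l => ?_)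
    (hasSum_zetaVal hpq).summable
  simp only [tornheimTerm, pow_zero, one_mul]
  rw [pow_add]
  apply one_div_le_one_div_of_le (by positivity)
  have : (l : ℝ) + 1 ≤ (i : ℝ) + l + 2 := by
    have : (0 : ℝ) ≤ i := by positivity
    linarith
  exact mul_le_mul_of_nonneg_left (pow_le_pow_left₀ (by positivity) this q) (by positivity)

/-- The ranges `0 < k < n`, `k > n` and `k < 0` of the two-sided series, for `n = i + 1`. -/
theorem bilateralSum_eq_add (p q i : ℕ) (hpq : 2 ≤ p + q) :
    bilateralSum (i + 1) p q =
      ∑ k ∈ range i, 1 / (((k : ℝ) + 1) ^ p * ((i : ℝ) - k) ^ q) +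
        (-1) ^ q * ∑' l : ℕ, tornheimTerm 0 q p (i, l) +
        (-1) ^ p * ∑' l : ℕ, tornheimTerm 0 p q (i, l) := by
  have h1 := (summable_tornheimTerm_row q p i (by omega)).hasSum.mul_left ((-1 : ℝ) ^ q)
  have h2 := (summable_tornheimTerm_row p q i hpq).hasSum.mul_left ((-1 : ℝ) ^ p)
  have h3 : HasSum (fun k : ℕ => bilateralTerm (i + 1) p q k)
      (∑ k ∈ range i, 1 / (((k : ℝ) + 1) ^ p * ((i : ℝ) - k) ^ q) +
        (-1) ^ q * ∑' l : ℕ, tornheimTerm 0 q p (i, l)) := by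
    have hs : ∑ k ∈ range (i + 2), bilateralTerm (i + 1) p q (k : ℕ) =
        ∑ k ∈ range i, 1 / (((k : ℝ) + 1) ^ p * ((i : ℝ) - k) ^ q) := by
      rw [Finset.sum_range_succ, Finset.sum_range_succ']
      have e1 : bilateralTerm (i + 1) p q ((i + 1 : ℕ) : ℤ) = 0 := by simp [bilateralTerm]
      have e2 : bilateralTerm (i + 1) p q ((0 : ℕ) : ℤ) = 0 := by simp [bilateralTerm]
      rw [e1, e2, add_zero, add_zero]
      refine Finset.sum_congr rfl fun k hk => ?_
      have hk := Finset.mem_range.1 hk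
      rw [bilateralTerm, if_neg (by push_cast; omega)]
      push_cast
      congr 3
      ring
    rw [← hasSum_nat_add_iff' (i + 2), hs, add_sub_cancel_left]
    refine hasSum_of_forall_eq (fun l => ?_) h1
    rw [bilateralTerm, if_neg (by push_cast; omega), tornheimTerm]
    have : ((i + 1 : ℕ) : ℝ) - (((l + (i + 2) : ℕ) : ℤ) : ℝ) = (-1) * ((l : ℝ) + 1) := by
      push_cast; ring
    rw [this, mul_pow, pow_zero, one_mul]
    have hpow : ((-1 : ℝ) ^ q) * (-1) ^ q = 1 := by rw [← mul_pow]; simp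
    have h0 : (-1 : ℝ) ^ q ≠ 0 := by positivity
    push_cast
    have : (l : ℝ) + (i + 2) = i + l + 2 := by ring
    rw [this]
    field_simp
    rw [sq, hpow]
  refine (HasSum.of_nat_of_neg_add_one h3 (hasSum_of_forall_eq (fun l => ?_) h2)).tsum_eq
  rw [bilateralTerm, if_neg (by push_cast; omega), tornheimTerm]
  have hpow : ((-1 : ℝ) ^ p) * (-1) ^ p = 1 := by rw [← mul_pow]; simp
  have e1 : ((-((l : ℤ) + 1) : ℤ) : ℝ) = (-1) * ((l : ℝ) + 1) := by push_cast; ring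
  have e2 : ((i + 1 : ℕ) : ℝ) - ((-((l : ℤ) + 1) : ℤ) : ℝ) = i + l + 2 := by push_cast; ring
  rw [e2, e1, mul_pow, pow_zero, one_mul]
  have h0 : (-1 : ℝ) ^ p ≠ 0 := by positivity
  field_simp
  rw [sq, hpow]

/-- Here the boundary values of the partial fraction recursion diverge, and the harmonic numbers
coming from the three ranges cancel instead. -/
theorem bilateralSum_one_one (i : ℕ) : bilateralSum (i + 1) 1 1 = -2 / ((i : ℝ) + 1) ^ 2 := by
  have hrow : ∑' l : ℕ, tornheimTerm 0 1 1 (i, l) = genHarmonic 1 (i + 1) / ((i + 1 : ℕ) : ℝ) := by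
    refine HasSum.tsum_eq (hasSum_of_forall_eq (fun l => ?_)
      (hasSum_one_div_mul_add (n := i + 1) (by omega)))
    simp only [tornheimTerm]
    push_cast
    ring_nf
  have hfin : ∑ k ∈ range i, 1 / (((k : ℝ) + 1) ^ 1 * ((i : ℝ) - k) ^ 1) =
      2 * genHarmonic 1 i / ((i : ℝ) + 1) := by
    have hrefl : genHarmonic 1 i = ∑ k ∈ range i, 1 / ((i : ℝ) - k) := by
      rw [genHarmonic_eq_sum_range, ← Finset.sum_range_reflect]
      refine Finset.sum_congr rfl fun k hk => ?_
      have hk := Finset.mem_range.1 hk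
      rw [show i - 1 - k = i - (k + 1) by omega, Nat.cast_sub (by omega)]
      push_cast
      ring
    rw [two_mul]
    nth_rewrite 1 [hrefl]
    rw [genHarmonic_eq_sum_range, ← Finset.sum_add_distrib, Finset.sum_div]
    refine Finset.sum_congr rfl fun k hk => ?_
    have hk : (k : ℝ) < i := by exact_mod_cast Finset.mem_range.1 hk
    have : (i : ℝ) - k ≠ 0 := by linarith
    field_simp
    ring
  rw [bilateralSum_eq_add 1 1 i (by omega), hrow, hfin, genHarmonic_succ]
  push_cast
  field_simp
  ring

/-- The contribution `∑_{t=0}^{p} C(t+q, q) n ^ {-(q+1+t)} x_{p+1-t}` of the boundary values `x` on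
one side to the solution of the recursion `n B(p+1, q+1) = B(p, q+1) + B(p+1, q)`. -/
noncomputable def partialFractionSum (n : ℝ) (x : ℕ → ℝ) (p q : ℕ) : ℝ :=
  ∑ t ∈ range (p + 1), ((t + q).choose q : ℝ) / n ^ (q + 1 + t) * x (p + 1 - t)

theorem partialFractionSum_zero_zero {n : ℝ} (hn : n ≠ 0) (x : ℕ → ℝ) :
    n * partialFractionSum n x 0 0 = x 1 := by
  simp [partialFractionSum]
  field_simp

theorem partialFractionSum_zero_succ {n : ℝ} (hn : n ≠ 0) (x : ℕ → ℝ) (q : ℕ) :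
    n * partialFractionSum n x 0 (q + 1) = partialFractionSum n x 0 q := by
  simp [partialFractionSum]
  field_simp
  ring

theorem partialFractionSum_succ_zero {n : ℝ} (hn : n ≠ 0) (x : ℕ → ℝ) (p : ℕ) :
    n * partialFractionSum n x (p + 1) 0 = partialFractionSum n x p 0 + x (p + 2) := by
  unfold partialFractionSum
  rw [Finset.sum_range_succ', mul_add, Finset.mul_sum]
  congr 1
  · refine Finset.sum_congr rfl fun t _ => ?_
    simp only [Nat.choose_zero_right, Nat.add_sub_add_right]
    rw [← add_assoc, pow_succ]
    field_simp
  · simp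
    field_simp

/-- Pascal's rule for the coefficients. -/
theorem partialFractionSum_succ_succ {n : ℝ} (hn : n ≠ 0) (x : ℕ → ℝ) (p q : ℕ) :
    n * partialFractionSum n x (p + 1) (q + 1) =
      partialFractionSum n x p (q + 1) + partialFractionSum n x (p + 1) q := by
  unfold partialFractionSum
  rw [Finset.sum_range_succ', Finset.sum_range_succ' _ (p + 1), mul_add, Finset.mul_sum,
    ← add_assoc (∑ t ∈ range (p + 1), _), ← Finset.sum_add_distrib]
  congr 1
  · refine Finset.sum_congr rfl fun t _ => ?_
    have h : ((t + 1 + (q + 1)).choose (q + 1) : ℝ) =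
        (t + (q + 1)).choose (q + 1) + (t + 1 + q).choose q := by
      rw [show t + 1 + (q + 1) = t + 1 + q + 1 by ring, Nat.choose_succ_succ,
        show t + (q + 1) = t + 1 + q by ring]
      push_cast
      ring
    simp only [Nat.add_sub_add_right]
    rw [h, show q + 1 + 1 + (t + 1) = q + 1 + 1 + t + 1 by ring,
      show q + 1 + (t + 1) = q + 1 + 1 + t by ring, pow_succ]
    field_simp
  · simp
    field_simp
    ring

/-- The solution of the partial fraction recursion in terms of the boundary values of `B`. -/
theorem eq_partialFractionSum {n : ℝ} (hn : n ≠ 0) {B : ℕ → ℕ → ℝ}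
    (hB : ∀ p q, n * B (p + 1) (q + 1) = B p (q + 1) + B (p + 1) q) (p q : ℕ) :
    B (p + 1) (q + 1) = partialFractionSum n (fun i => B i 0) p q +
      partialFractionSum n (fun j => B 0 j) q p := by
  induction p generalizing q with
  | zero =>
    induction q with
    | zero =>
      apply mul_left_cancel₀ hn
      rw [hB, mul_add, partialFractionSum_zero_zero hn, partialFractionSum_zero_zero hn]
      ring
    | succ q ih =>
      apply mul_left_cancel₀ hn
      rw [hB, ih, mul_add, partialFractionSum_zero_succ hn, partialFractionSum_succ_zero hn]
      ring
  | succ p ihp =>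
    induction q with
    | zero =>
      apply mul_left_cancel₀ hn
      rw [hB, ihp, mul_add, partialFractionSum_zero_succ hn, partialFractionSum_succ_zero hn]
      ring
    | succ q ihq =>
      apply mul_left_cancel₀ hn
      rw [hB, ihp, ihq, mul_add, partialFractionSum_succ_succ hn, partialFractionSum_succ_succ hn]
      ring

/-- In the boundary values only the even zeta values survive, since `∑_{k ≠ 0} k ^ {-p}` vanishes
for odd `p`. -/
theorem bilateralSum_succ_succ (i p q : ℕ) :
    bilateralSum (i + 1) (p + 1) (q + 1) =
      partialFractionSum ((i : ℝ) + 1)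
        (fun j => (1 + (-1) ^ j) * zetaVal j - 1 / ((i : ℝ) + 1) ^ j) p q +
      partialFractionSum ((i : ℝ) + 1)
        (fun j => (1 + (-1) ^ j) * zetaVal j - 1 / ((i : ℝ) + 1) ^ j) q p := by
  have hn : (i : ℝ) + 1 ≠ 0 := by positivity
  -- For `p + q = 1` the series converges only conditionally; its symmetric value is `-1 / n`.
  let B : ℕ → ℕ → ℝ := fun p q =>
    if p + q = 1 then -1 / ((i : ℝ) + 1) else bilateralSum (i + 1) p q
  have hB : ∀ p q, ((i : ℝ) + 1) * B (p + 1) (q + 1) = B p (q + 1) + B (p + 1) q := by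
    intro p q
    simp only [B]
    rw [if_neg (by omega)]
    by_cases h : p + q = 0
    · obtain ⟨rfl, rfl⟩ : p = 0 ∧ q = 0 := by omega
      simp only [zero_add, add_zero, if_true]
      rw [bilateralSum_one_one]
      field_simp
      ring
    · rw [if_neg (by omega), if_neg (by omega), ← mul_bilateralSum_succ_succ (by omega)]
      push_cast
      ring
  have hright : ∀ j, 1 ≤ j →
      B j 0 = (1 + (-1) ^ j) * zetaVal j - 1 / ((i : ℝ) + 1) ^ j := by
    intro j hj
    simp only [B]
    split_ifs with h
    · obtain rfl : j = 1 := by omega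
      simp
      ring
    · rw [bilateralSum_zero_right (by omega) (by omega)]
      push_cast
      ring
  have hleft : ∀ j, 1 ≤ j →
      B 0 j = (1 + (-1) ^ j) * zetaVal j - 1 / ((i : ℝ) + 1) ^ j := by
    intro j hj
    rw [← hright j hj]
    simp only [B]
    rw [add_comm 0 j, bilateralSum_comm, add_zero]
  have h := eq_partialFractionSum hn hB p q
  have hpq : B (p + 1) (q + 1) = bilateralSum (i + 1) (p + 1) (q + 1) := by
    simp only [B]
    rw [if_neg (by omega)]
  rw [← hpq, h]
  unfold partialFractionSum
  congr 1
  · refine Finset.sum_congr rfl fun t ht => ?_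
    have := Finset.mem_range.1 ht
    beta_reduce
    rw [hright (p + 1 - t) (by omega)]
  · refine Finset.sum_congr rfl fun t ht => ?_
    have := Finset.mem_range.1 ht
    beta_reduce
    rw [hleft (q + 1 - t) (by omega)]

theorem sum_Icc_one_add_neg_one_pow (p : ℕ) (f : ℕ → ℝ) :
    ∑ i ∈ Icc 1 p, (1 + (-1) ^ i) * f i = 2 * ∑ k ∈ Icc 1 (p / 2), f (2 * k) := by
  induction p with
  | zero => simp
  | succ p ih =>
    rw [Finset.sum_Icc_succ_top (by omega), ih]
    rcases Nat.even_or_odd' p with ⟨u, rfl | rfl⟩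
    · rw [show (2 * u + 1) / 2 = u by omega, show 2 * u / 2 = u by omega]
      simp [pow_succ, pow_mul]
    · rw [show (2 * u + 1 + 1) / 2 = u + 1 by omega, show (2 * u + 1) / 2 = u by omega,
        Finset.sum_Icc_succ_top (by omega), show 2 * u + 1 + 1 = 2 * (u + 1) by ring, pow_mul]
      norm_num
      ring

/-- Summing the partial fractions over `n`: the terms `n ^ {-(q+1+t)}` become zeta values, and the
corrections `-1 / n ^ j` all contribute `ζ(p+q+2)`, with the hockey-stick sum of binomials. -/
theorem hasSum_partialFractionSum (p : ℕ) {q : ℕ} (hq : 1 ≤ q) :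
    HasSum (fun i : ℕ => partialFractionSum ((i : ℝ) + 1)
        (fun j => (1 + (-1) ^ j) * zetaVal j - 1 / ((i : ℝ) + 1) ^ j) p q)
      (2 * ∑ k ∈ Icc 1 ((p + 1) / 2), ((p + q + 1 - 2 * k).choose q : ℝ) * zetaVal (2 * k) *
          zetaVal (p + q + 2 - 2 * k) - ((p + q + 1).choose (q + 1) : ℝ) * zetaVal (p + q + 2)) := by
  have h1 : ∀ t ∈ range (p + 1), HasSum (fun i : ℕ =>
      ((t + q).choose q : ℝ) / ((i : ℝ) + 1) ^ (q + 1 + t) *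
        ((1 + (-1) ^ (p + 1 - t)) * zetaVal (p + 1 - t) - 1 / ((i : ℝ) + 1) ^ (p + 1 - t)))
      ((1 + (-1) ^ (p + 1 - t)) *
          (((t + q).choose q : ℝ) * zetaVal (p + 1 - t) * zetaVal (q + 1 + t)) -
        ((t + q).choose q : ℝ) * zetaVal (p + q + 2)) := by
    intro t ht
    have ht := Finset.mem_range.1 ht
    have ha := (hasSum_zetaVal (k := q + 1 + t) (by omega)).mul_left
      ((1 + (-1) ^ (p + 1 - t)) * (((t + q).choose q : ℝ) * zetaVal (p + 1 - t)))
    have hb := (hasSum_zetaVal (k := p + q + 2) (by omega)).mul_left ((t + q).choose q : ℝ)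
    rw [← mul_assoc (1 + (-1 : ℝ) ^ (p + 1 - t))]
    refine hasSum_of_forall_eq (fun i => ?_) (ha.sub hb)
    rw [show p + q + 2 = (q + 1 + t) + (p + 1 - t) by omega]
    have hne : (i : ℝ) + 1 ≠ 0 := by positivity
    generalize p + 1 - t = r
    generalize q + 1 + t = s
    rw [pow_add]
    field_simp
  have h2 := hasSum_sum h1
  unfold partialFractionSum
  convert! h2 using 1
  rw [Finset.sum_sub_distrib, ← Finset.sum_mul]
  congr 1
  · rw [← sum_Icc_one_add_neg_one_pow (p + 1)
      (fun k => ((p + q + 1 - k).choose q : ℝ) * zetaVal k * zetaVal (p + q + 2 - k)), sum_Icc_one,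
      ← Finset.sum_range_reflect]
    refine Finset.sum_congr rfl fun t ht => ?_
    have ht := Finset.mem_range.1 ht
    rw [show p + 1 - 1 - t + 1 = p + 1 - t by omega,
      show p + q + 1 - (p + 1 - t) = t + q by omega,
      show p + q + 2 - (p + 1 - t) = q + 1 + t by omega]
  · rw [← Nat.sum_range_add_choose]
    push_cast
    rfl

/-- The two-sided series summed over `n`, split by the signs of `k` and `n - k`. -/
theorem hasSum_bilateralSum {p q : ℕ} (hp : 2 ≤ p) (hq : 2 ≤ q) :
    HasSum (fun i : ℕ => bilateralSum (i + 1) p q)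
      (zetaVal p * zetaVal q + (-1) ^ q * tornheim 0 q p + (-1) ^ p * tornheim 0 p q) := by
  have h1 : HasSum (fun i : ℕ => ∑ k ∈ range i, 1 / (((k : ℝ) + 1) ^ p * ((i : ℝ) - k) ^ q))
      (zetaVal p * zetaVal q) := by
    rw [← hasSum_nat_add_iff' 1]
    have hp' := hasSum_zetaVal hp
    have hq' := hasSum_zetaVal hq
    have h := (hp'.mul hq' (hp'.summable.mul_of_nonneg hq'.summable (fun n => by positivity)
      (fun n => by positivity))).sum_antidiagonal
    simp only [Finset.sum_range_one, Finset.sum_range_zero, sub_zero]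
    refine hasSum_of_forall_eq (fun n => ?_) h
    rw [Finset.Nat.sum_antidiagonal_eq_sum_range_succ_mk]
    refine Finset.sum_congr rfl fun j hj => ?_
    have hjn : j ≤ n := Nat.lt_succ_iff.1 (Finset.mem_range.1 hj)
    rw [Nat.cast_sub hjn, div_mul_div_comm, one_mul]
    push_cast
    ring_nf
  have h2 : ∀ {p q : ℕ}, 2 ≤ p → 2 ≤ q →
      HasSum (fun i : ℕ => ∑' l : ℕ, tornheimTerm 0 p q (i, l)) (tornheim 0 p q) := by
    intro p q hp hq
    exact (summable_tornheimTerm (a := 0) (b := p) (by omega) hq).hasSum.prod_fiberwise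
      fun i => (summable_tornheimTerm_row p q i (by omega)).hasSum
  exact hasSum_of_forall_eq (fun i => bilateralSum_eq_add p q i (by omega))
    ((h1.add ((h2 hq hp).mul_left _)).add ((h2 hp hq).mul_left _))

/-- Evaluating the sum over `n` of the two-sided series in two ways. For odd weight the signs of
`T(0, p, q)` and `T(0, q, p)` differ, so that together with the symmetric sum relation both are
determined. -/
theorem eulerSum_eq_eulerSumValue {a b : ℕ} (ha : 1 ≤ a) (hb : 2 ≤ b) (hodd : Odd (a + b)) :
    eulerSum a b = eulerSumValue a b := by
  rcases Nat.lt_or_ge a 2 with h | ha2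
  · obtain rfl : a = 1 := by omega
    exact eulerSum_one_eq_eulerSumValue hb hodd
  obtain ⟨p, rfl⟩ : ∃ p, a = p + 1 := ⟨a - 1, by omega⟩
  obtain ⟨q, rfl⟩ : ∃ q, b = q + 1 := ⟨b - 1, by omega⟩
  have h1 := hasSum_bilateralSum ha2 hb
  have h2 := (hasSum_partialFractionSum p (q := q) (by omega)).add
    (hasSum_partialFractionSum q (q := p) (by omega))
  have h3 := h1.unique (hasSum_of_forall_eq (fun i => bilateralSum_succ_succ i p q) h2)
  have h4 := tornheim_add_tornheim_swap ha2 hb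
  have h5 := eulerSum_eq_tornheim (s := p + 1) (c := q + 1) ha hb
  have hsign : (-1 : ℝ) ^ (q + 1) = -(-1) ^ (p + 1) := by
    have h6 := hodd.neg_one_pow (α := ℝ)
    rw [pow_add] at h6
    rcases neg_one_pow_eq_or ℝ (p + 1) with h7 | h7 <;> rw [h7] at h6 ⊢ <;> linarith
  have hsq : (-1 : ℝ) ^ (p + 1) * (-1) ^ (p + 1) = 1 := by rw [← mul_pow]; simp
  rw [eulerSumValue]
  rw [show p + 1 + (q + 1) = p + q + 2 by ring] at *
  rw [add_comm q p] at h3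
  have e1 : ∀ k, p + q + 2 - 2 * k - 1 = p + q + 1 - 2 * k := fun k => by omega
  simp only [e1, Nat.add_sub_cancel, show p + q + 2 - 1 = p + q + 1 by omega]
  rw [hsign] at h3
  generalize (-1 : ℝ) ^ (p + 1) = ε at *
  have h7 : tornheim 0 (q + 1) (p + 1) =
      zetaVal (p + 1) * zetaVal (q + 1) - zetaVal (p + q + 2) - tornheim 0 (p + 1) (q + 1) := by
    linarith
  rw [h5]
  rw [h7] at h3
  linear_combination (ε / 2) * h3 - (tornheim 0 (p + 1) (q + 1) + zetaVal (p + q + 2) / 2 -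
    zetaVal (p + 1) * zetaVal (q + 1) / 2) * hsq

/-! ### The integrals as Tornheim series -/

theorem tornheim_pos {a b c : ℕ} (h : Summable (tornheimTerm a b c)) : 0 < tornheim a b c :=
  h.tsum_pos (tornheimTerm_nonneg a b c) (0, 0) (by unfold tornheimTerm; positivity)

theorem abs_log_pow_mul_pow_le (r : ℕ) {n : ℕ} (hn : 1 ≤ n) {x : ℝ} (hx : x ∈ Set.Ioc (0 : ℝ) 1) :
    |Real.log x ^ r * x ^ n| ≤ (r : ℝ) ^ r := by
  have hx0 : 0 < x := hx.1
  have hxn : x ^ n ≤ x := by simpa using pow_le_pow_of_le_one hx0.le hx.2 hn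
  rcases Nat.eq_zero_or_pos r with rfl | hr
  · rw [pow_zero, one_mul, abs_of_pos (by positivity), pow_zero]
    exact hxn.trans hx.2
  have h := (Real.abs_log_mul_self_rpow_lt x (1 / r) hx0 hx.2 (by positivity)).le
  rw [one_div_one_div] at h
  have h2 : |Real.log x ^ r * x| ≤ (r : ℝ) ^ r := by
    have h3 := pow_le_pow_left₀ (abs_nonneg _) h r
    rwa [← abs_pow, mul_pow, ← Real.rpow_natCast (x ^ (1 / (r : ℝ))), ← Real.rpow_mul hx0.le,
      one_div_mul_cancel (by positivity), Real.rpow_one] at h3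
  refine le_trans ?_ h2
  rw [abs_mul, abs_mul, abs_of_pos hx0, abs_of_pos (pow_pos hx0 n)]
  gcongr

theorem integrableOn_log_pow_mul_pow (r : ℕ) {n : ℕ} (hn : 1 ≤ n) :
    IntegrableOn (fun x : ℝ => Real.log x ^ r * x ^ n) (Set.Ioc 0 1) := by
  refine Measure.integrableOn_of_bounded (M := (r : ℝ) ^ r) (by simp)
    (by fun_prop) ?_
  refine (ae_restrict_iff' measurableSet_Ioc).2 (Filter.Eventually.of_forall fun x hx => ?_)
  exact abs_log_pow_mul_pow_le r hn hx

theorem tendsto_log_pow_mul_pow (r n : ℕ) :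
    Filter.Tendsto (fun x : ℝ => Real.log x ^ (r + 1) * x ^ (n + 1)) (nhdsWithin 0 (Set.Ioi 0))
      (nhds 0) := by
  have h1 := (tendsto_log_mul_rpow_nhdsGT_zero (r := 1 / ((r + 1 : ℕ) : ℝ)) (by positivity)).pow
    (r + 1)
  have h2 : Filter.Tendsto (fun x : ℝ => x ^ n) (nhdsWithin 0 (Set.Ioi 0)) (nhds (0 ^ n)) :=
    ((continuous_pow n).tendsto 0).mono_left nhdsWithin_le_nhds
  have h3 := h1.mul h2
  rw [zero_pow (by omega), zero_mul] at h3
  refine h3.congr' ?_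
  filter_upwards [self_mem_nhdsWithin] with x hx
  have hx0 : (0 : ℝ) < x := hx
  rw [mul_pow, ← Real.rpow_natCast (x ^ _), ← Real.rpow_mul hx0.le,
    one_div_mul_cancel (by positivity), Real.rpow_one]
  ring

/-- `∫_0^1 log ^ r (x) x ^ n dx = (-1) ^ r r! / (n + 1) ^ (r + 1)`, by integration by parts. -/
theorem integral_log_pow_mul_pow (r : ℕ) {n : ℕ} (hn : 1 ≤ n) :
    ∫ x in (0 : ℝ)..1, Real.log x ^ r * x ^ n =
      (-1) ^ r * (r.factorial : ℝ) / ((n : ℝ) + 1) ^ (r + 1) := by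
  induction r with
  | zero => simp [integral_pow]
  | succ r ih =>
    have hi : ∀ r : ℕ, IntervalIntegrable (fun x : ℝ => Real.log x ^ r * x ^ n) volume 0 1 :=
      fun r => (intervalIntegrable_iff_integrableOn_Ioc_of_le zero_le_one).2
        (integrableOn_log_pow_mul_pow r hn)
    have h := intervalIntegral.integral_eq_sub_of_hasDerivAt_of_tendsto (a := (0 : ℝ)) (b := 1)
      (f := fun x : ℝ => Real.log x ^ (r + 1) * x ^ (n + 1))
      (f' := fun x : ℝ => ((r : ℝ) + 1) * (Real.log x ^ r * x ^ n) +
        ((n : ℝ) + 1) * (Real.log x ^ (r + 1) * x ^ n)) zero_lt_one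
      (fa := 0) (fb := 0) (fun x hx => ?_)
      (((hi r).const_mul _).add ((hi (r + 1)).const_mul _)) (tendsto_log_pow_mul_pow r n) ?_
    · rw [intervalIntegral.integral_add ((hi r).const_mul _) ((hi (r + 1)).const_mul _),
        intervalIntegral.integral_const_mul, intervalIntegral.integral_const_mul, ih] at h
      have hn0 : (n : ℝ) + 1 ≠ 0 := by positivity
      apply mul_left_cancel₀ hn0
      rw [eq_sub_of_add_eq' h, Nat.factorial_succ]
      push_cast
      field_simp
      ring
    · have hx0 : x ≠ 0 := hx.1.ne'
      have h1 := ((Real.hasDerivAt_log hx0).pow (r + 1)).mul (hasDerivAt_pow (n + 1) x)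
      convert! h1 using 1
      simp only [Nat.add_sub_cancel, Pi.pow_apply]
      push_cast
      field_simp
      ring
    · have hc : ContinuousAt (fun x : ℝ => Real.log x ^ (r + 1) * x ^ (n + 1)) 1 :=
        ((Real.continuousAt_log one_ne_zero).pow _).mul (continuousAt_id.pow _)
      have := hc.tendsto.mono_left (nhdsWithin_le_nhds (s := Set.Iio 1))
      simpa using this

theorem hasSum_polyLog (p : ℕ) {x : ℝ} (hx : x ∈ Set.Ioo (0 : ℝ) 1) :
    HasSum (fun n : ℕ => x ^ (n + 1) / ((n : ℝ) + 1) ^ p) (polyLog p x) := by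
  refine Summable.hasSum (Summable.of_nonneg_of_le (fun n => ?_) (fun n => ?_)
    (summable_geometric_of_lt_one hx.1.le hx.2))
  · have := hx.1.le
    positivity
  · have h0 := hx.1.le
    calc x ^ (n + 1) / ((n : ℝ) + 1) ^ p ≤ x ^ (n + 1) :=
          div_le_self (by positivity) (one_le_pow₀ (by simp))
      _ ≤ x ^ n := pow_le_pow_of_le_one h0 hx.2.le (by omega)

/-- The double series expansion of the integrand on `(0, 1)`. -/
theorem hasSum_kIntegrand (r a b : ℕ) {x : ℝ} (hx : x ∈ Set.Ioo (0 : ℝ) 1) :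
    HasSum (fun y : ℕ × ℕ => 1 / (((y.1 : ℝ) + 1) ^ a * ((y.2 : ℝ) + 1) ^ b) *
      (Real.log x ^ r * x ^ (y.1 + y.2 + 1))) (kIntegrand r a b x) := by
  have ha := hasSum_polyLog a hx
  have hb := hasSum_polyLog b hx
  have hx0 := hx.1
  have h := (ha.mul hb (ha.summable.mul_of_nonneg hb.summable
    (fun n => by positivity) (fun n => by positivity))).mul_left (Real.log x ^ r / x)
  have e : kIntegrand r a b x = Real.log x ^ r / x * (polyLog a x * polyLog b x) := by
    rw [kIntegrand]; ring
  rw [e]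
  refine hasSum_of_forall_eq (fun y => ?_) h
  have : x ^ (y.1 + 1) * x ^ (y.2 + 1) = x * x ^ (y.1 + y.2 + 1) := by ring
  rw [div_mul_div_comm, this]
  field_simp

/-- Termwise integration; all terms have the constant sign `(-1) ^ r`, so the series of the
integrals of the absolute values is `r!` times the Tornheim series. -/
theorem kInt_eq_tornheim {r a b : ℕ} (hr : 1 ≤ r) (hab : 1 ≤ a + b) :
    kInt r a b = (-1) ^ r * (r.factorial : ℝ) * tornheim a b (r + 1) := by
  have hT := summable_tornheimTerm (a := a) (b := b) (c := r + 1) hab (by omega)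
  have hval : ∀ y : ℕ × ℕ, ∫ x in Set.Ioc (0 : ℝ) 1,
      1 / (((y.1 : ℝ) + 1) ^ a * ((y.2 : ℝ) + 1) ^ b) *
        (Real.log x ^ r * x ^ (y.1 + y.2 + 1)) =
      (-1) ^ r * (r.factorial : ℝ) * tornheimTerm a b (r + 1) y := by
    intro y
    rw [integral_const_mul, ← intervalIntegral.integral_of_le zero_le_one,
      integral_log_pow_mul_pow r (by omega), tornheimTerm]
    push_cast
    rw [show (y.1 : ℝ) + y.2 + 1 + 1 = y.1 + y.2 + 2 by ring]
    field_simp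
  have hnorm : ∀ y : ℕ × ℕ, ∫ x in Set.Ioc (0 : ℝ) 1,
      ‖1 / (((y.1 : ℝ) + 1) ^ a * ((y.2 : ℝ) + 1) ^ b) *
        (Real.log x ^ r * x ^ (y.1 + y.2 + 1))‖ =
      (r.factorial : ℝ) * tornheimTerm a b (r + 1) y := by
    intro y
    have hsq : (-1 : ℝ) ^ r * (-1) ^ r = 1 := by rw [← mul_pow]; simp
    have : (r.factorial : ℝ) * tornheimTerm a b (r + 1) y =
        (-1) ^ r * ((-1) ^ r * (r.factorial : ℝ) * tornheimTerm a b (r + 1) y) := by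
      rw [← mul_assoc, ← mul_assoc, hsq, one_mul]
    rw [this, ← hval y, ← integral_const_mul]
    refine setIntegral_congr_fun measurableSet_Ioc fun x hx => ?_
    have hlog : |Real.log x| = -Real.log x := abs_of_nonpos (Real.log_nonpos hx.1.le hx.2)
    have hx0 := hx.1
    rw [norm_mul, norm_mul, Real.norm_of_nonneg (by positivity), norm_pow, Real.norm_eq_abs, hlog,
      Real.norm_of_nonneg (by positivity), neg_pow (Real.log x)]
    ring
  have h := hasSum_integral_of_summable_integral_norm (μ := volume.restrict (Set.Ioc (0 : ℝ) 1))
    (F := fun (y : ℕ × ℕ) (x : ℝ) => 1 / (((y.1 : ℝ) + 1) ^ a * ((y.2 : ℝ) + 1) ^ b) *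
        (Real.log x ^ r * x ^ (y.1 + y.2 + 1)))
    (fun y => (integrableOn_log_pow_mul_pow r (by omega)).const_mul _)
    ((hT.mul_left (r.factorial : ℝ)).congr fun y => (hnorm y).symm)
  have hcongr : ∫ x in Set.Ioc (0 : ℝ) 1, (∑' y : ℕ × ℕ,
      1 / (((y.1 : ℝ) + 1) ^ a * ((y.2 : ℝ) + 1) ^ b) *
        (Real.log x ^ r * x ^ (y.1 + y.2 + 1))) = kInt r a b := by
    rw [kInt, intervalIntegral.integral_of_le zero_le_one, integral_Ioc_eq_integral_Ioo,
      integral_Ioc_eq_integral_Ioo]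
    exact setIntegral_congr_fun measurableSet_Ioo fun x hx => (hasSum_kIntegrand r a b hx).tsum_eq
  rw [← hcongr]
  refine h.unique ?_
  simp_rw [hval]
  exact hT.hasSum.mul_left _

/-- The value of the integral is nonzero, whereas a divergent integral has the default value `0`. -/
theorem intervalIntegrable_kIntegrand {r a b : ℕ} (hr : 1 ≤ r) (hab : 1 ≤ a + b) :
    IntervalIntegrable (kIntegrand r a b) volume 0 1 := by
  by_contra hcon
  have h := kInt_eq_tornheim hr hab
  rw [kInt, intervalIntegral.integral_undef hcon] at h
  have hpos := tornheim_pos (summable_tornheimTerm (a := a) (b := b) (c := r + 1) hab (by omega))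
  have : (-1 : ℝ) ^ r * (r.factorial : ℝ) * tornheim a b (r + 1) ≠ 0 :=
    mul_ne_zero (mul_ne_zero (by positivity) (by positivity)) hpos.ne'
  exact this h.symm

theorem kInt_comm {r a b : ℕ} (hr : 1 ≤ r) (hab : 1 ≤ a + b) : kInt r a b = kInt r b a := by
  rw [kInt_eq_tornheim hr hab, kInt_eq_tornheim hr (by omega), tornheim_comm]

theorem kInt_zero_left {r s : ℕ} (hr : 1 ≤ r) (hs : 1 ≤ s) :
    kInt r 0 s =
      (r.factorial : ℝ) * (-1) ^ r * (eulerSum s (r + 1) - zetaVal (r + s + 1)) := by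
  rw [kInt_eq_tornheim hr (by omega), eulerSum_eq_tornheim hs (by omega),
    show s + (r + 1) = r + s + 1 by ring]
  ring

/-! ### The reduction of `K(m, p, q)` -/

/-- The recursion obtained by integrating `log ^ m (x) / x` by parts. -/
theorem kInt_succ_succ {m : ℕ} (hm : 1 ≤ m) (p q : ℕ) :
    kInt m (p + 1) (q + 1) =
      -1 / ((m : ℝ) + 1) * (kInt (m + 1) p (q + 1) + kInt (m + 1) (p + 1) q) := by
  rw [kInt_eq_tornheim hm (by omega), kInt_eq_tornheim (by omega) (by omega),
    kInt_eq_tornheim (by omega) (by omega), tornheim_succ_succ (by omega), Nat.factorial_succ]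
  have : (m : ℝ) + 1 ≠ 0 := by positivity
  push_cast
  field_simp
  ring

theorem poch_zero (t : ℕ) : poch t 0 = 1 := by simp [poch]

theorem poch_one (t : ℕ) : poch t 1 = t := by simp [poch, Nat.ascFactorial]

theorem poch_add (t l k : ℕ) : poch t (l + k) = poch t l * poch (t + l) k := by
  unfold poch
  rw [← Nat.ascFactorial_mul_ascFactorial]
  push_cast
  ring

/-- The recursion `kInt_succ_succ` iterated until one of the indices has dropped: the second
index by one, or the first to zero. -/
theorem kInt_succ_right {m : ℕ} (hm : 1 ≤ m) (p q : ℕ) :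
    kInt m p (q + 1) =
      ∑ i ∈ Icc 1 p, (-1) ^ i / poch (m + 1) i * kInt (m + i) (p - i + 1) q +
        (-1) ^ p / poch (m + 1) p * kInt (m + p) 0 (q + 1) := by
  induction p generalizing m with
  | zero => simp [poch_zero]
  | succ p ih =>
    have hp : ∀ i, poch (m + 1) (i + 1) = ((m : ℝ) + 1) * poch (m + 1 + 1) i := by
      intro i
      rw [add_comm i 1, poch_add, poch_one]
      push_cast
      ring
    have hc : ∀ i, (-1 : ℝ) ^ (i + 1) / poch (m + 1) (i + 1) =
        -1 / ((m : ℝ) + 1) * ((-1) ^ i / poch (m + 1 + 1) i) := by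
      intro i
      rw [hp, div_mul_div_comm, pow_succ']
    rw [kInt_succ_succ hm, ih (by omega), sum_Icc_one, sum_Icc_one, Finset.sum_range_succ', hc 0,
      poch_zero, add_assoc m 1 p, add_comm 1 p]
    simp_rw [hc]
    rw [mul_add, mul_add, Finset.mul_sum]
    have hs : ∀ i ∈ range p,
        -1 / ((m : ℝ) + 1) * ((-1) ^ (i + 1) / poch (m + 1 + 1) (i + 1) *
          kInt (m + 1 + (i + 1)) (p - (i + 1) + 1) q) =
        -1 / ((m : ℝ) + 1) * ((-1) ^ (i + 1) / poch (m + 1 + 1) (i + 1)) *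
          kInt (m + (i + 1 + 1)) (p + 1 - (i + 1 + 1) + 1) q := by
      intro i _
      rw [show m + 1 + (i + 1) = m + (i + 1 + 1) by ring,
        show p + 1 - (i + 1 + 1) = p - (i + 1) by omega]
      ring
    rw [Finset.sum_congr rfl hs]
    simp only [zero_add, Nat.add_sub_cancel, pow_zero, div_one, mul_one]
    ring

theorem nestedSum_mul_left (k p : ℕ) (c : ℝ) (f : List ℕ → ℝ) :
    nestedSum k p (fun l => c * f l) = c * nestedSum k p f := by
  induction k generalizing p f with
  | zero => rfl
  | succ k ih =>
    simp only [nestedSum, Finset.mul_sum]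
    exact Finset.sum_congr rfl fun i _ => ih _ _

/-- Applying `kInt_succ_right` repeatedly to the terms that keep both indices: the terms whose
first index drops to zero at step `x` have the common weight `m + p + x - 1`, so their coefficients
collapse and only the number of index tuples remains. -/
theorem kInt_eq_nestedSum {m : ℕ} (hm : 1 ≤ m) (p q : ℕ) :
    kInt m p q =
      ∑ x ∈ Icc 1 q, kInt (m + p + x - 1) 0 (q - x + 1) *
          ((-1) ^ (p + x - 1) / poch (m + 1) (p + x - 1)) * nestedSum (x - 1) p (fun _ => 1)
        + nestedSum q p
            (fun i => nestedCoeff m i * kInt (m + i.sum) (p + q - i.sum) 0) := by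
  induction q generalizing m p with
  | zero => simp [nestedSum, nestedCoeff]
  | succ q ih =>
    have hterm : ∀ i ∈ Icc 1 p, (-1) ^ i / poch (m + 1) i * kInt (m + i) (p - i + 1) q =
        ∑ x ∈ Icc 1 q, kInt (m + p + (x + 1) - 1) 0 (q + 1 - (x + 1) + 1) *
            ((-1) ^ (p + (x + 1) - 1) / poch (m + 1) (p + (x + 1) - 1)) *
            nestedSum (x - 1) (p - i + 1) (fun _ => 1) +
          nestedSum q (p - i + 1) (fun l => nestedCoeff m (i :: l) *
            kInt (m + (i :: l).sum) (p + (q + 1) - (i :: l).sum) 0) := by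
      intro i hi
      have hi := Finset.mem_Icc.1 hi
      rw [ih (by omega), mul_add, Finset.mul_sum, ← nestedSum_mul_left]
      congr 1
      · refine Finset.sum_congr rfl fun x hx => ?_
        have hx := Finset.mem_Icc.1 hx
        rw [show m + i + (p - i + 1) + x - 1 = m + p + (x + 1) - 1 by omega,
          show q + 1 - (x + 1) + 1 = q - x + 1 by omega,
          show p + (x + 1) - 1 = i + (p - i + 1 + x - 1) by omega, poch_add, pow_add,
          show m + i + 1 = m + 1 + i by ring, ← div_mul_div_comm]
        ring
      · congr 1
        funext l
        simp only [nestedCoeff, List.sum_cons]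
        rw [show p - i + 1 + q - l.sum = p + (q + 1) - (i + l.sum) by omega,
          show m + i + l.sum = m + (i + l.sum) by ring]
        ring
    rw [kInt_succ_right hm, Finset.sum_congr rfl hterm, Finset.sum_add_distrib, Finset.sum_comm,
      sum_Icc_one (q + 1), Finset.sum_range_succ', sum_Icc_one q]
    have h1 : ∀ x ∈ range q, ∑ i ∈ Icc 1 p,
        kInt (m + p + (x + 1 + 1) - 1) 0 (q + 1 - (x + 1 + 1) + 1) *
            ((-1) ^ (p + (x + 1 + 1) - 1) / poch (m + 1) (p + (x + 1 + 1) - 1)) *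
            nestedSum (x + 1 - 1) (p - i + 1) (fun _ => 1) =
        kInt (m + p + (x + 1 + 1) - 1) 0 (q + 1 - (x + 1 + 1) + 1) *
            ((-1) ^ (p + (x + 1 + 1) - 1) / poch (m + 1) (p + (x + 1 + 1) - 1)) *
            nestedSum (x + 1 + 1 - 1) p (fun _ => 1) := by
      intro x _
      rw [← Finset.mul_sum]
      rfl
    rw [Finset.sum_congr rfl h1]
    simp only [zero_add, Nat.add_sub_cancel, nestedSum, Nat.sub_self, mul_one]
    ring

/-! ### Reduction to zeta values -/

theorem ratCast_mul_mem_span {S : Set ℝ} (c : ℚ) {x : ℝ} (hx : x ∈ Submodule.span ℚ S) :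
    (c : ℝ) * x ∈ Submodule.span ℚ S := by
  rw [← Rat.smul_def]
  exact Submodule.smul_mem _ c hx

theorem zetaVal_mem_span (w : ℕ) : zetaVal w ∈ Submodule.span ℚ (zetaProducts w) :=
  Submodule.subset_span (Or.inl rfl)

theorem zetaVal_mul_zetaVal_mem_span {a b w : ℕ} (ha : 1 ≤ a) (hb : 1 ≤ b) (hw : a + b = w) :
    zetaVal a * zetaVal b ∈ Submodule.span ℚ (zetaProducts w) := by
  by_cases ha1 : a = 1
  · rw [ha1, zetaVal_one, zero_mul]
    exact Submodule.zero_mem _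
  by_cases hb1 : b = 1
  · rw [hb1, zetaVal_one, mul_zero]
    exact Submodule.zero_mem _
  exact Submodule.subset_span (Or.inr ⟨a, b, by omega, by omega, hw, rfl⟩)

theorem eulerSumValue_mem_span {a b : ℕ} (ha : 1 ≤ a) (hb : 1 ≤ b) :
    eulerSumValue a b ∈ Submodule.span ℚ (zetaProducts (a + b)) := by
  have hsum : ∀ c d : ℕ, c ≤ a + b - 1 →
      (-1) ^ a * ∑ k ∈ Icc 1 (c / 2), ((a + b - 2 * k - 1).choose d : ℝ) * zetaVal (2 * k) *
        zetaVal (a + b - 2 * k) ∈ Submodule.span ℚ (zetaProducts (a + b)) := by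
    intro c d hc
    rw [Finset.mul_sum]
    refine Submodule.sum_mem _ fun k hk => ?_
    have hk := Finset.mem_Icc.1 hk
    have h := ratCast_mul_mem_span ((-1) ^ a * ((a + b - 2 * k - 1).choose d : ℚ))
      (zetaVal_mul_zetaVal_mem_span (a := 2 * k) (b := a + b - 2 * k) (w := a + b)
        (by omega) (by omega) (by omega))
    convert h using 1
    push_cast
    ring
  unfold eulerSumValue
  refine Submodule.add_mem _ (Submodule.add_mem _ (Submodule.add_mem _ ?_ ?_)
    (hsum a (b - 1) (by omega))) (hsum b (a - 1) (by omega))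
  · have h := ratCast_mul_mem_span (1 / 2 - (-1) ^ a / 2 * ((a + b - 1).choose a : ℚ)
      - (-1) ^ a / 2 * ((a + b - 1).choose b : ℚ)) (zetaVal_mem_span (a + b))
    convert h using 1
    push_cast
    ring
  · have h := ratCast_mul_mem_span ((1 - (-1) ^ a) / 2) (zetaVal_mul_zetaVal_mem_span ha hb rfl)
    convert h using 1
    push_cast
    ring

theorem kInt_mem_span {w : ℕ} (hw : Even w) {m p q : ℕ} (hm : 1 ≤ m) (hpq : 1 ≤ p + q)
    (h : m + p + q = w) : kInt m p q ∈ Submodule.span ℚ (zetaProducts (w + 1)) := by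
  have hbase : ∀ r s : ℕ, 1 ≤ r → 1 ≤ s → r + s = w →
      kInt r 0 s ∈ Submodule.span ℚ (zetaProducts (w + 1)) := by
    intro r s hr hs hrs
    have hodd : Odd (s + (r + 1)) := by
      rw [show s + (r + 1) = w + 1 by omega]
      exact hw.add_one
    have hmem := eulerSumValue_mem_span (b := r + 1) hs (by omega)
    rw [← eulerSum_eq_eulerSumValue hs (by omega) hodd, show s + (r + 1) = w + 1 by omega] at hmem
    have h := ratCast_mul_mem_span ((r.factorial : ℚ) * (-1) ^ r)
      (Submodule.sub_mem _ hmem (zetaVal_mem_span (w + 1)))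
    rw [kInt_zero_left hr hs, hrs]
    convert h using 1
    push_cast
    ring
  induction p generalizing m q with
  | zero => exact hbase m q hm (by omega) (by omega)
  | succ p ihp =>
    induction q generalizing m with
    | zero =>
      rw [kInt_comm hm (by omega)]
      exact hbase m (p + 1) hm (by omega) (by omega)
    | succ q ihq =>
      rw [kInt_succ_succ hm]
      have h := ratCast_mul_mem_span (-1 / ((m : ℚ) + 1)) (Submodule.add_mem _
        (ihp (m := m + 1) (q := q + 1) (by omega) (by omega) (by omega))
        (ihq (m := m + 1) (by omega) (by omega) (by omega)))
      convert h using 1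
      push_cast
      ring

theorem theorem6 (m p q : ℕ) (hm : 1 ≤ m) (hq : 1 ≤ q) (hpq : q ≤ p) :
    (∀ r a b : ℕ, 1 ≤ r → 1 ≤ a + b →
      IntervalIntegrable (kIntegrand r a b) volume (0 : ℝ) 1) ∧
    kInt m p q =
      ∑ x ∈ Icc 1 q, kInt (m + p + x - 1) 0 (q - x + 1) *
          ((-1) ^ (p + x - 1) / poch (m + 1) (p + x - 1)) * nestedSum (x - 1) p (fun _ => 1)
        + nestedSum q p
            (fun i => nestedCoeff m i * kInt (m + i.sum) (p + q - i.sum) 0) ∧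
    (∀ r s : ℕ, 1 ≤ r → 1 ≤ s →
      Summable (eulerTerm s (r + 1)) ∧
      kInt r 0 s =
        (r.factorial : ℝ) * (-1) ^ r * (eulerSum s (r + 1) - zetaVal (r + s + 1)) ∧
      kInt r s 0 = kInt r 0 s) ∧
    (Even (m + p + q) →
      (∀ r s : ℕ, 1 ≤ r → 1 ≤ s → r + s = m + p + q →
        eulerSum s (r + 1) = eulerSumValue s (r + 1)) ∧
      kInt m p q ∈ Submodule.span ℚ (zetaProducts (m + p + q + 1))) := by
  refine ⟨fun r a b hr hab => intervalIntegrable_kIntegrand hr hab, kInt_eq_nestedSum hm p q,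
    fun r s hr hs => ⟨(hasSum_eulerTerm hs (by omega)).summable, kInt_zero_left hr hs,
      kInt_comm hr (by omega)⟩, fun heven => ⟨fun r s hr hs hrs => ?_,
      kInt_mem_span heven hm (by omega) rfl⟩⟩
  refine eulerSum_eq_eulerSumValue hs (by omega) ?_
  rw [show s + (r + 1) = m + p + q + 1 by omega]
  exact heven.add_one
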